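/- For $\tau$ in the upper half-plane let \[ A(\tau)=\left(\frac{\eta(\tau)^9}{\eta(3\tau)^3}+27\,\frac{\eta(3\tau)^9}{\eta(\tau)^3}\right)^{1/3},\qquad B(\tau)=\tfrac14\big(E_2(\tau)+3E_2(3\tau)\big),\qquad C(\tau)=\frac{\eta(\tau)^9}{\eta(3\tau)^3}, \] where $\eta$ is the Dedekind eta function, $E_2$ is the weight $2$ Eisenstein series normalized to have constant term $1$, and the cube root is the branch with limit $1$ as $\operatorname{Im}\tau\to\infty$. These are quasimodular forms for $\Gamma_1(3)$, regarded as germs of functions at $\tau=i\infty$. For $k\ge 0$ let $\mathbb{Q}[A,B,C]_k$ be the space of polynomials in $A,B,C$ with rational coefficients that are homogeneous of weight $k$, where $A,B,C$ have weights $1,2,3$. Let $\mathbb{Q}[X,S]_{\le k}$ be the space of polynomials of total degree at most $k$ in two variables $X,S$ (with $\deg X=\deg S=1$). For a subspace $V\subset \mathbb{Q}[X^{\pm1},S]$ let $[V]^{\mathrm{reg}}$ be the space of those $f\in V$ such that every monomial $X^iS^k$ occurring in $f$ satisfies $3i+k\ge 0$. Then, for every $g\ge 2$, the substitution \[ X=\frac{A^3}{C},\qquad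 S=\frac{AB-A^3}{6C} \] induces a $\mathbb{Q}$-linear isomorphism \[ \big[X^{-(g-1)}\cdot\mathbb{Q}[X,S]_{\le 3g-3}\big]^{\mathrm{reg}}\;\xrightarrow{\ \sim\ }\;C^{-(2g-2)}\cdot\mathbb{Q}[A,B,C]_{6g-6}. \] -/

import Mathlib

noncomputable section

open UpperHalfPlane hiding I
open Filter Polynomial LaurentPolynomial

namespace LocalP2

/-! ### The quasimodular forms `A`, `B`, `C` for `Γ₁(3)` -/

/-- The point `3τ` of the upper half-plane. -/
def threeMul (τ : ℍ) : ℍ :=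
  ⟨3 * (τ : ℂ), by simpa using τ.im_pos⟩

/-- `C(τ) = η(τ)⁹ / η(3τ)³`. -/
def formC (τ : ℍ) : ℂ :=
  ModularForm.eta τ ^ 9 / ModularForm.eta (threeMul τ) ^ 3

/-- `A(τ) = (η(τ)⁹ / η(3τ)³ + 27 η(3τ)⁹ / η(τ)³) ^ (1/3)`. The radicand tends to `1` as
`Im τ → ∞`, so that the principal branch is, near `i∞`, the holomorphic cube root
`1 + 6𝒬 + ⋯`, where `𝒬 = exp (2πiτ)`. -/
def formA (τ : ℍ) : ℂ :=
  (ModularForm.eta τ ^ 9 / ModularForm.eta (threeMul τ) ^ 3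
    + 27 * (ModularForm.eta (threeMul τ) ^ 9 / ModularForm.eta τ ^ 3)) ^ (1 / 3 : ℂ)

/-- `B(τ) = (E₂(τ) + 3 E₂(3τ)) / 4`. -/
def formB (τ : ℍ) : ℂ :=
  (1 / 4) * (EisensteinSeries.E2 τ + 3 * EisensteinSeries.E2 (threeMul τ))

/-- Germs at `i∞` of complex functions on the upper half-plane: two functions are identified
when they agree at all `τ` with `Im τ` large enough. A meromorphic function on the upper
half-plane is determined by its germ, and `A` and `C` (which tend to `1` at `i∞`) have
invertible germs, although `A` vanishes at some points of the upper half-plane. -/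
abbrev CuspGerm : Type := Germ atImInfty ℂ

instance instAlgebraCuspGerm : Algebra ℚ CuspGerm :=
  Algebra.ofModule
    (fun r x y => by
      induction x using Germ.inductionOn with | h f => ?_
      induction y using Germ.inductionOn with | h g => ?_
      exact congrArg _ (smul_mul_assoc r f g))
    (fun r x y => by
      induction x using Germ.inductionOn with | h f => ?_
      induction y using Germ.inductionOn with | h g => ?_
      exact congrArg _ (mul_smul_comm r f g))

/-- The quasimodular form `A`, as a germ at `i∞`. -/
def qA : CuspGerm := (formA : ℍ → ℂ)

/-- The quasimodular form `B`, as a germ at `i∞`. -/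
def qB : CuspGerm := (formB : ℍ → ℂ)

/-- The quasimodular form `C`, as a germ at `i∞`. -/
def qC : CuspGerm := (formC : ℍ → ℂ)

/-- The space `ℚ[A,B,C]_k` of polynomials in `A`, `B`, `C`, of weight `k`, where `A`, `B`, `C`
have weights `1`, `2`, `3`. -/
def weightPart (k : ℕ) : Submodule ℚ CuspGerm :=
  (MvPolynomial.weightedHomogeneousSubmodule ℚ (![1, 2, 3] : Fin 3 → ℕ) k).map
    (MvPolynomial.aeval ![qA, qB, qC] : MvPolynomial (Fin 3) ℚ →ₐ[ℚ] CuspGerm).toLinearMap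

/-- The space `C^{-(2g-2)} · ℚ[A,B,C]_{6g-6}`. -/
def quasimodularSpace (g : ℕ) : Submodule ℚ CuspGerm :=
  (weightPart (6 * g - 6)).map (LinearMap.mulLeft ℚ (qC ^ (-(2 * (g : ℤ) - 2))))

/-! ### Polynomials in `X^{±1}` and `S` -/

/-- The ring `ℚ[X^{±1}, S]`, as the Laurent polynomials in `X` over `ℚ[S]`: the coefficient of
`X ^ i * S ^ k` in `f` is `(f.coeff i).coeff k`. -/
abbrev LaurentXS : Type := LaurentPolynomial ℚ[X]

/-- The inclusion `ℚ[X, S] → ℚ[X^{±1}, S]`; the first variable is `X`, the second one is `S`. -/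
def ofPoly : MvPolynomial (Fin 2) ℚ →ₐ[ℚ] LaurentXS :=
  MvPolynomial.aeval ![LaurentPolynomial.T 1, LaurentPolynomial.C Polynomial.X]

/-- The space `X^{-(g-1)} · ℚ[X,S]_{≤ 3g-3}`, where `deg X = deg S = 1`. -/
def shiftedSpace (g : ℕ) : Submodule ℚ LaurentXS :=
  ((MvPolynomial.restrictTotalDegree (Fin 2) ℚ (3 * g - 3)).map ofPoly.toLinearMap).map
    (LinearMap.mulLeft ℚ (LaurentPolynomial.T (-((g : ℤ) - 1))))

/-- Orbifold regularity `3 deg_X + deg_S ≥ 0`: every monomial `X ^ i * S ^ k` that occurs in `f`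
satisfies `3 i + k ≥ 0`. -/
def orbifoldRegular : Submodule ℚ LaurentXS where
  carrier := {f | ∀ (i : ℤ) (k : ℕ), (f.coeff i).coeff k ≠ 0 → 0 ≤ 3 * i + k}
  zero_mem' := by intro i k h; simp at h
  add_mem' := by
    intro f f' hf hf' i k h
    by_cases h0 : (f.coeff i).coeff k = 0
    · refine hf' i k fun h1 => h ?_
      simp [h0, h1]
    · exact hf i k h0
  smul_mem' := by
    intro r f hf i k h
    refine hf i k fun h0 => h ?_
    simp [h0]

/-- The space `[X^{-(g-1)} · ℚ[X,S]_{≤ 3g-3}]^{reg}`. -/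
def regularSpace (g : ℕ) : Submodule ℚ LaurentXS :=
  shiftedSpace g ⊓ orbifoldRegular

/-! ### The expression of `X` and `S` in terms of `A`, `B`, `C` -/

/-- `X = A³ / C`. -/
def qX : CuspGerm := qA ^ 3 / qC

/-- `S = (AB - A³) / (6C)`. -/
def qS : CuspGerm := (qA * qB - qA ^ 3) / (6 * qC)

/-- The substitution `f(X, S) ↦ f(A³ / C, (AB - A³) / (6C))`. -/
def substABC (f : LaurentXS) : CuspGerm :=
  f.coeff.sum fun i p => qX ^ i * Polynomial.aeval qS p

end LocalP2

end

noncomputable section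

open UpperHalfPlane hiding I
open Filter Polynomial LaurentPolynomial

namespace LocalP2

open scoped Manifold Topology

/-! With `B' = (B - A²)/6` one has `S = (A/C) B'`, hence `X^i S^k = C^{-(2g-2)} · A^{3i+k} B'^k
C^{2g-2-i-k}`. The exponents on the right are nonnegative exactly when the monomial is regular and
`i + k ≤ 2g-2`, and their total weight is `6g-6`. As `A`, `B'`, `C` generate the same weighted ring
as `A`, `B`, `C`, the image is the required space (`map_regularSpace`).

Injectivity is the algebraic independence of `X` and `S`, equivalently of `X` and `AB/C`. The
principal cube root makes `A` usable only near the cusp, so a relation is first replaced by one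
between `X = 1 + 27t` and `(AB/C)³ = X B³/C²`, both holomorphic on all of `ℍ` (`exists_dvd_expand`).
This relation extends to `ℍ` by the identity theorem. Evaluated at the Fricke images of `τ + 24n`,
the first argument is constant in `n`, while the anomaly of `E₂` makes the second a polynomial in
`1/(τ + 24n)`, nonconstant if `x ≠ 0`. Infinitely many `n` then kill every coefficient of the
relation (`eq_zero_of_evalEval_cubeForm`). -/

/-! ### Eta quotients and their behaviour at the cusp -/

/-- `t(τ) = (η(3τ) / η(τ)) ^ 12`, a Hauptmodul for `Γ₀(3)`. -/
def hauptmodul (τ : ℍ) : ℂ :=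
  ModularForm.eta (threeMul τ) ^ 12 / ModularForm.eta τ ^ 12

lemma coe_threeMul (τ : ℍ) : (threeMul τ : ℂ) = 3 * τ := rfl

lemma im_threeMul (τ : ℍ) : (threeMul τ).im = 3 * τ.im := by
  rw [← coe_im, coe_threeMul]; simp

lemma eta_coe_ne_zero (τ : ℍ) : ModularForm.eta τ ≠ 0 :=
  ModularForm.eta_ne_zero τ.2

lemma hauptmodul_ne_zero (τ : ℍ) : hauptmodul τ ≠ 0 :=
  div_ne_zero (pow_ne_zero _ (eta_coe_ne_zero _)) (pow_ne_zero _ (eta_coe_ne_zero _))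

lemma formC_ne_zero (τ : ℍ) : formC τ ≠ 0 :=
  div_ne_zero (pow_ne_zero _ (eta_coe_ne_zero _)) (pow_ne_zero _ (eta_coe_ne_zero _))

/-- Cubing removes the choice of branch, so this holds at every `τ`, not only near the cusp. -/
lemma formA_pow_three (τ : ℍ) : formA τ ^ 3 = (1 + 27 * hauptmodul τ) * formC τ := by
  have h1 := eta_coe_ne_zero τ
  have h2 := eta_coe_ne_zero (threeMul τ)
  have h := Complex.cpow_nat_inv_pow (ModularForm.eta τ ^ 9 / ModularForm.eta (threeMul τ) ^ 3
    + 27 * (ModularForm.eta (threeMul τ) ^ 9 / ModularForm.eta τ ^ 3)) (n := 3) (by norm_num)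
  rw [formA, one_div, hauptmodul, formC]
  push_cast at h
  rw [h]
  field_simp

lemma tendsto_threeMul_atImInfty : Tendsto threeMul atImInfty atImInfty := by
  rw [atImInfty, tendsto_comap_iff]
  have : UpperHalfPlane.im ∘ threeMul = fun τ ↦ 3 * τ.im := funext im_threeMul
  rw [this]
  exact tendsto_comap.const_mul_atTop (by norm_num)

/-- The square of `t` is `Δ(3τ)/Δ(τ)`, which is `q²` times a quotient of infinite products tending
to `1`. -/
lemma tendsto_hauptmodul_atImInfty : Tendsto hauptmodul atImInfty (𝓝 0) := by
  let P : ℍ → ℂ := fun τ ↦ ∏' n : ℕ, (1 - ModularForm.eta_q n τ) ^ 24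
  have hP : Tendsto P atImInfty (𝓝 1) := ModularForm.tendsto_atImInfty_tprod_one_sub_eta_q_pow
  have hq := qParam_tendsto_atImInfty zero_lt_one
  have hsq : Tendsto (fun τ ↦ hauptmodul τ ^ 2) atImInfty (𝓝 0) := by
    have h := (hq.pow 2).mul ((hP.comp tendsto_threeMul_atImInfty).div hP one_ne_zero)
    simp only [ne_eq, OfNat.ofNat_ne_zero, not_false_eq_true, zero_pow, zero_mul] at h
    refine h.congr fun τ ↦ ?_
    have e1 := ModularForm.discriminant_eq_q_prod τ
    have e2 := ModularForm.discriminant_eq_q_prod (threeMul τ)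
    have hq3 : Function.Periodic.qParam 1 (threeMul τ) = Function.Periodic.qParam 1 τ ^ 3 := by
      simp only [Function.Periodic.qParam, coe_threeMul, ← Complex.exp_nat_mul]
      congr 1; push_cast; ring
    have h0 : Function.Periodic.qParam 1 (τ : ℂ) ≠ 0 := Function.Periodic.qParam_ne_zero _
    rw [hauptmodul, div_pow, ← pow_mul, ← pow_mul]
    change _ = ModularForm.discriminant (threeMul τ) / ModularForm.discriminant τ
    rw [e1, e2, hq3]
    have hPne : P τ ≠ 0 := fun h ↦ ModularForm.discriminant_ne_zero τ (by rw [e1]; simp [P] at h; simp [h])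
    change _ * (P (threeMul τ) / P τ) = _ * P (threeMul τ) / (_ * P τ)
    field_simp
  rw [tendsto_zero_iff_norm_tendsto_zero] at hsq ⊢
  have := hsq.sqrt
  simpa using this

lemma eventually_one_add_hauptmodul_ne_zero :
    ∀ᶠ τ in atImInfty, 1 + 27 * hauptmodul τ ≠ 0 := by
  have h := (tendsto_hauptmodul_atImInfty.const_mul 27).const_add 1
  exact h.eventually_ne (by norm_num)


/-! ### Holomorphy and the identity theorem at the cusp -/

lemma mdifferentiable_eta : MDiff (fun τ : ℍ ↦ ModularForm.eta τ) := by
  rw [UpperHalfPlane.mdifferentiable_iff]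
  have h : DifferentiableOn ℂ ModularForm.eta upperHalfPlaneSet := fun z hz ↦
    (ModularForm.differentiableAt_eta_of_mem_upperHalfPlaneSet hz).differentiableWithinAt
  refine h.congr fun z hz ↦ ?_
  simp [ofComplex_apply_of_im_pos hz]

lemma mdifferentiable_comp_threeMul {f : ℍ → ℂ} (hf : MDiff f) : MDiff (f ∘ threeMul) := by
  rw [UpperHalfPlane.mdifferentiable_iff] at hf ⊢
  have h3 : Set.MapsTo (fun z : ℂ ↦ 3 * z) upperHalfPlaneSet upperHalfPlaneSet := fun z hz ↦ by
    simpa using hz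
  refine (hf.comp (f := fun z : ℂ ↦ 3 * z) (by fun_prop) h3).congr fun z hz ↦ ?_
  simp only [Function.comp_apply]
  rw [ofComplex_apply_of_im_pos hz, ofComplex_apply_of_im_pos (h3 hz)]
  rfl

lemma mdifferentiable_hauptmodul : MDiff hauptmodul := by
  have h1 := UpperHalfPlane.mdifferentiable_iff.1 mdifferentiable_eta
  have h2 := UpperHalfPlane.mdifferentiable_iff.1 (mdifferentiable_comp_threeMul mdifferentiable_eta)
  exact UpperHalfPlane.mdifferentiable_iff.2 <| (h2.pow 12).div (h1.pow 12) fun z _ ↦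
    pow_ne_zero _ (eta_coe_ne_zero _)

lemma mdifferentiable_formC : MDiff formC := by
  have h1 := UpperHalfPlane.mdifferentiable_iff.1 mdifferentiable_eta
  have h2 := UpperHalfPlane.mdifferentiable_iff.1 (mdifferentiable_comp_threeMul mdifferentiable_eta)
  exact UpperHalfPlane.mdifferentiable_iff.2 <| (h1.pow 9).div (h2.pow 3) fun z _ ↦
    pow_ne_zero _ (eta_coe_ne_zero _)

lemma mdifferentiable_formB : MDiff formB := by
  have h1 := UpperHalfPlane.mdifferentiable_iff.1 E2_mdifferentiable
  have h2 := UpperHalfPlane.mdifferentiable_iff.1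
    (mdifferentiable_comp_threeMul E2_mdifferentiable)
  exact UpperHalfPlane.mdifferentiable_iff.2 <| (h1.add (h2.const_mul 3)).const_mul (1 / 4)

lemma differentiableOn_evalEval {f g : ℂ → ℂ} {s : Set ℂ} (hf : DifferentiableOn ℂ f s)
    (hg : DifferentiableOn ℂ g s) (R : ℂ[X][X]) :
    DifferentiableOn ℂ (fun z ↦ R.evalEval (f z) (g z)) s := by
  induction R using Polynomial.induction_on' with
  | add p q hp hq => simpa using hp.fun_add hq
  | monomial n p =>
    have : DifferentiableOn ℂ (fun z ↦ p.eval (f z)) s := p.differentiable.comp_differentiableOn hf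
    simpa [evalEval] using this.fun_mul (hg.fun_pow n)

/-- A holomorphic function on the upper half-plane that vanishes near `i∞` vanishes. -/
lemma eq_zero_of_eventually_atImInfty {f : ℍ → ℂ} (hf : MDiff f)
    (h : ∀ᶠ τ in atImInfty, f τ = 0) : f = 0 := by
  obtain ⟨a, ha⟩ := (atImInfty_mem _).1 h
  let τ₀ : ℍ := ⟨Complex.I * (|a| + 1 : ℝ), by simp; positivity⟩
  have him : τ₀.im = |a| + 1 := by rw [← coe_im]; simp [τ₀]
  refine UpperHalfPlane.eq_zero_of_frequently hf (τ := τ₀) ?_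
  have hev : ∀ᶠ z in 𝓝 τ₀, f z = 0 := by
    have : ∀ᶠ z : ℍ in 𝓝 τ₀, a < z.im :=
      (UpperHalfPlane.continuous_im.tendsto τ₀).eventually_const_lt
        (by rw [him]; linarith [le_abs_self a])
    filter_upwards [this] with z hz using ha z hz.le
  have : (𝓝[≠] τ₀).NeBot := by
    infer_instance
  exact (hev.filter_mono nhdsWithin_le_nhds).frequently

/-! ### The Fricke involution -/

/-- The Fricke involution `τ ↦ -1 / (3τ)`. -/
def fricke (τ : ℍ) : ℍ := ModularGroup.S • threeMul τ

lemma threeMul_fricke (τ : ℍ) : threeMul (fricke τ) = ModularGroup.S • τ := by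
  ext
  have := τ.ne_zero
  rw [coe_threeMul, fricke, modular_S_smul, modular_S_smul]
  simp [coe_threeMul]
  field_simp

lemma csqrt_sq (z : ℂ) : Complex.sqrt z ^ 2 = z :=
  Complex.cpow_nat_inv_pow z two_ne_zero

/-- Squaring eliminates the square roots in the transformation law of `η`; this is why only `C²`,
and not `C`, is transformed below. -/
lemma eta_S_smul_sq (τ : ℍ) :
    ModularForm.eta ↑(ModularGroup.S • τ) ^ 2 = -Complex.I * τ * ModularForm.eta τ ^ 2 := by
  have he : ModularForm.eta (-(τ : ℂ)⁻¹) =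
      (Complex.sqrt Complex.I)⁻¹ * (Complex.sqrt τ * ModularForm.eta τ) := by
    simpa [neg_div] using ModularForm.eta_comp_eq_csqrt_I_inv τ.2
  have h : ((ModularGroup.S • τ : ℍ) : ℂ) = -(τ : ℂ)⁻¹ := by
    rw [modular_S_smul]; simp [inv_neg]
  rw [h, he, mul_pow, mul_pow, inv_pow, csqrt_sq, csqrt_sq, Complex.inv_I]
  ring

lemma E2_S_smul (τ : ℍ) : EisensteinSeries.E2 (ModularGroup.S • τ) =
    τ ^ 2 * EisensteinSeries.E2 τ - 6 * Complex.I / Real.pi * τ := by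
  have h := congrFun (EisensteinSeries.E2_slash_action ModularGroup.S) τ
  have hτ := τ.ne_zero
  have hπ : (Real.pi : ℂ) ≠ 0 := by exact_mod_cast Real.pi_ne_zero
  rw [ModularForm.SL_slash_apply] at h
  simp only [Pi.sub_apply, Pi.smul_apply, EisensteinSeries.D2_S, riemannZeta_two,
    ModularGroup.denom_S, smul_eq_mul] at h
  rw [zpow_neg, ← div_eq_mul_inv, div_eq_iff (by exact zpow_ne_zero _ hτ)] at h
  rw [h, zpow_ofNat]
  field_simp

lemma hauptmodul_fricke (τ : ℍ) : hauptmodul (fricke τ) = (729 * hauptmodul τ)⁻¹ := by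
  have h1 := eta_coe_ne_zero τ
  have h2 := eta_coe_ne_zero (threeMul τ)
  have hτ := τ.ne_zero
  have hI := Complex.I_ne_zero
  have e1 := eta_S_smul_sq τ
  have e2 := eta_S_smul_sq (threeMul τ)
  rw [hauptmodul, threeMul_fricke, fricke, show 12 = 2 * 6 from rfl, pow_mul, pow_mul, e1, e2,
    hauptmodul]
  have h3 : (threeMul τ : ℂ) ≠ 0 := (threeMul τ).ne_zero
  field_simp
  rw [coe_threeMul]
  ring

lemma formC_fricke_sq (τ : ℍ) : formC (fricke τ) ^ 2 =
    -19683 * τ ^ 6 * (ModularForm.eta (threeMul τ) ^ 18 / ModularForm.eta τ ^ 6) := by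
  have h1 := eta_coe_ne_zero τ
  have h2 := eta_coe_ne_zero (threeMul τ)
  have hτ := τ.ne_zero
  have hI := Complex.I_ne_zero
  have e1 := eta_S_smul_sq τ
  have e2 := eta_S_smul_sq (threeMul τ)
  rw [formC, threeMul_fricke, fricke, div_pow, ← pow_mul, ← pow_mul, show 9 * 2 = 2 * 9 from rfl,
    show 3 * 2 = 2 * 3 from rfl, pow_mul, pow_mul _ 2 3, e1, e2]
  generalize ModularForm.eta (threeMul τ) = y at *
  rw [coe_threeMul]
  have hI6 : Complex.I ^ 6 = -1 := by
    rw [show 6 = 4 + 2 from rfl, pow_add, Complex.I_pow_four, Complex.I_sq]; ring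
  field_simp
  rw [hI6]
  ring

lemma formB_fricke (τ : ℍ) : formB (fricke τ) =
    3 * τ ^ 2 * formB τ - 9 * Complex.I / Real.pi * τ := by
  rw [formB, threeMul_fricke, fricke, E2_S_smul, E2_S_smul, coe_threeMul, formB]
  ring

/-! ### Periodicity -/

lemma exp_two_pi_I_mul_add_nat (z : ℂ) (n : ℕ) :
    Complex.exp (2 * Real.pi * Complex.I * (z + n)) = Complex.exp (2 * Real.pi * Complex.I * z) := by
  rw [mul_add, mul_comm _ (n : ℂ)]
  exact Complex.exp_periodic.nat_mul n _

/-- The period `24` comes from the factor `q^{1/24}` of `η`. -/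
lemma eta_add_nat (z : ℂ) (n : ℕ) : ModularForm.eta (z + (24 * n : ℕ)) = ModularForm.eta z := by
  have h1 : Function.Periodic.qParam 24 (z + (24 * n : ℕ)) = Function.Periodic.qParam 24 z := by
    have h := exp_two_pi_I_mul_add_nat (z / 24) n
    simp only [Function.Periodic.qParam]
    convert h using 2 <;> (push_cast; ring)
  have h2 : Function.Periodic.qParam 1 (z + (24 * n : ℕ)) = Function.Periodic.qParam 1 z := by
    have h := exp_two_pi_I_mul_add_nat z (24 * n)
    simpa [Function.Periodic.qParam] using h
  simp only [ModularForm.eta, ModularForm.eta_q, h1, h2]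

lemma E2_vadd (τ : ℍ) (n : ℕ) :
    EisensteinSeries.E2 (((n : ℕ) : ℝ) +ᵥ τ) = EisensteinSeries.E2 τ := by
  simp only [EisensteinSeries.E2, Pi.smul_apply, EisensteinSeries.G2_eq_tsum_cexp]
  have : Complex.exp (2 * Real.pi * Complex.I * ↑((n : ℝ) +ᵥ τ)) =
      Complex.exp (2 * Real.pi * Complex.I * τ) := by
    rw [coe_vadd, add_comm]
    exact exp_two_pi_I_mul_add_nat τ n
  simp only [this]

lemma threeMul_vadd (τ : ℍ) (n : ℕ) :
    threeMul ((n : ℝ) +ᵥ τ) = ((3 * n : ℕ) : ℝ) +ᵥ threeMul τ := by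
  ext
  simp [coe_threeMul, mul_add]

lemma eta_vadd (τ : ℍ) (n : ℕ) :
    ModularForm.eta ↑(((24 * n : ℕ) : ℝ) +ᵥ τ) = ModularForm.eta τ := by
  rw [← eta_add_nat τ n, coe_vadd, add_comm]; simp

lemma eta_threeMul_vadd (τ : ℍ) (n : ℕ) :
    ModularForm.eta (threeMul (((24 * n : ℕ) : ℝ) +ᵥ τ)) = ModularForm.eta (threeMul τ) := by
  rw [threeMul_vadd, mul_left_comm, eta_vadd]

lemma formB_vadd (τ : ℍ) (n : ℕ) : formB ((n : ℝ) +ᵥ τ) = formB τ := by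
  rw [formB, threeMul_vadd, E2_vadd, E2_vadd, formB]

lemma hauptmodul_vadd (τ : ℍ) (n : ℕ) :
    hauptmodul (((24 * n : ℕ) : ℝ) +ᵥ τ) = hauptmodul τ := by
  rw [hauptmodul, eta_vadd, eta_threeMul_vadd, hauptmodul]

/-! ### Algebraic independence -/

/-- The function `X B³ / C²`, which is the cube of `A B / C` and is holomorphic on the whole upper
half-plane. -/
def cubeForm (τ : ℍ) : ℂ := (1 + 27 * hauptmodul τ) * formB τ ^ 3 / formC τ ^ 2

lemma mdifferentiable_cubeForm : MDiff cubeForm := by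
  have h1 := UpperHalfPlane.mdifferentiable_iff.1 mdifferentiable_hauptmodul
  have h2 := UpperHalfPlane.mdifferentiable_iff.1 mdifferentiable_formB
  have h3 := UpperHalfPlane.mdifferentiable_iff.1 mdifferentiable_formC
  exact UpperHalfPlane.mdifferentiable_iff.2 <|
    (((h1.const_mul 27).const_add 1).mul (h2.pow 3)).div (h3.pow 2) fun z _ ↦
      pow_ne_zero _ (formC_ne_zero _)

/-- The weights of `B³` and `C²` cancel, so `n` survives only through the non-modular term of `E₂`.
-/
lemma cubeForm_fricke_vadd (τ : ℍ) (n : ℕ) :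
    cubeForm (fricke (((24 * n : ℕ) : ℝ) +ᵥ τ)) =
      (1 + 27 * (729 * hauptmodul τ)⁻¹) *
        (3 * formB τ - 9 * Complex.I / Real.pi * ((τ : ℂ) + (24 * n : ℕ))⁻¹) ^ 3 *
        (-19683 * (ModularForm.eta (threeMul τ) ^ 18 / ModularForm.eta τ ^ 6))⁻¹ := by
  set σ : ℍ := ((24 * n : ℕ) : ℝ) +ᵥ τ with hσ
  have hc : (τ + (24 * n : ℕ) : ℂ) = σ := by rw [hσ, coe_vadd, add_comm]; simp
  have hσ0 := σ.ne_zero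
  have h1 := eta_coe_ne_zero τ
  have h2 := eta_coe_ne_zero (threeMul τ)
  rw [cubeForm, hauptmodul_fricke, formC_fricke_sq, formB_fricke, hc, hσ, hauptmodul_vadd,
    eta_vadd, eta_threeMul_vadd, formB_vadd, ← hσ]
  have e : 3 * (σ : ℂ) ^ 2 * formB τ - 9 * Complex.I / Real.pi * σ =
      σ ^ 2 * (3 * formB τ - 9 * Complex.I / Real.pi * (σ : ℂ)⁻¹) := by
    field_simp
  rw [e, mul_pow, ← pow_mul]
  generalize 3 * formB τ - 9 * Complex.I / Real.pi * (σ : ℂ)⁻¹ = b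
  generalize 1 + 27 * (729 * hauptmodul τ)⁻¹ = x
  field_simp
  ring

/-- A polynomial vanishing at all values of the Fricke transform of `X` is zero. -/
lemma eq_zero_of_eval_hauptmodul_inv {p : ℂ[X]}
    (h : ∀ τ, p.eval (1 + 27 * (729 * hauptmodul τ)⁻¹) = 0) : p = 0 := by
  by_contra hp
  let r : Set ℂ := hauptmodul '' Set.univ
  have hr : r.Finite := by
    have : (fun t : ℂ ↦ 1 + 27 * (729 * t)⁻¹) '' r ⊆ p.rootSet ℂ := by
      rintro _ ⟨_, ⟨τ, -, rfl⟩, rfl⟩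
      rw [mem_rootSet]
      exact ⟨hp, by simpa using h τ⟩
    refine Set.Finite.of_finite_image ((p.rootSet_finite ℂ).subset this) ?_
    intro a _ b _ hab
    simpa using hab
  -- A finite value set omitting `0` stays away from `0`, whereas `t → 0` at the cusp.
  have h0 : rᶜ ∈ 𝓝 (0 : ℂ) := hr.isClosed.isOpen_compl.mem_nhds (by
    rintro ⟨τ, -, hτ⟩
    exact hauptmodul_ne_zero τ hτ)
  obtain ⟨τ, hτ⟩ := (tendsto_hauptmodul_atImInfty.eventually h0).exists
  exact hτ ⟨τ, trivial, rfl⟩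

/-- `X` and `X B³ / C²` are algebraically independent. -/
lemma eq_zero_of_evalEval_cubeForm {R : ℂ[X][X]}
    (h : ∀ᶠ τ in atImInfty, R.evalEval (1 + 27 * hauptmodul τ) (cubeForm τ) = 0) : R = 0 := by
  have hall : (fun τ : ℍ ↦ R.evalEval (1 + 27 * hauptmodul τ) (cubeForm τ)) = 0 := by
    refine eq_zero_of_eventually_atImInfty ?_ h
    have h1 := UpperHalfPlane.mdifferentiable_iff.1 mdifferentiable_hauptmodul
    have h2 := UpperHalfPlane.mdifferentiable_iff.1 mdifferentiable_cubeForm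
    exact UpperHalfPlane.mdifferentiable_iff.2
      (differentiableOn_evalEval ((h1.const_mul 27).const_add 1) h2 R)
  have hπ : (Real.pi : ℂ) ≠ 0 := by exact_mod_cast Real.pi_ne_zero
  -- The extra factor `X` disposes of the points with `x = 0`, where the polynomial `q` below is
  -- constant.
  suffices H : ∀ (τ : ℍ) (j : ℕ),
      (Polynomial.X * R.coeff j).eval (1 + 27 * (729 * hauptmodul τ)⁻¹) = 0 by
    ext1 j
    have := eq_zero_of_eval_hauptmodul_inv fun τ ↦ H τ j
    simpa using this
  intro τ j
  have hx : ∀ n : ℕ, 1 + 27 * hauptmodul (fricke (((24 * n : ℕ) : ℝ) +ᵥ τ)) =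
      1 + 27 * (729 * hauptmodul τ)⁻¹ := fun n ↦ by rw [hauptmodul_fricke, hauptmodul_vadd]
  have hw := cubeForm_fricke_vadd τ
  set x := 1 + 27 * (729 * hauptmodul τ)⁻¹
  set d := (-19683 * (ModularForm.eta (threeMul τ) ^ 18 / ModularForm.eta τ ^ 6))⁻¹ with hd
  have hd0 : d ≠ 0 := inv_ne_zero <| mul_ne_zero (by norm_num) <|
    div_ne_zero (pow_ne_zero _ (eta_coe_ne_zero _)) (pow_ne_zero _ (eta_coe_ne_zero _))
  by_cases hx0 : x = 0
  · simp [hx0]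
  set c := 9 * Complex.I / Real.pi
  have hc0 : c ≠ 0 := div_ne_zero (mul_ne_zero (by norm_num) Complex.I_ne_zero) hπ
  let q : ℂ[X] := Polynomial.C x * (Polynomial.C (3 * formB τ) - Polynomial.C c * Polynomial.X) ^ 3 *
    Polynomial.C d
  let p : ℂ[X] := R.map (evalRingHom x)
  have hcomp : p.comp q = 0 := by
    refine eq_zero_of_infinite_isRoot _ (Set.Infinite.mono ?_
      (Set.infinite_range_of_injective (f := fun n : ℕ ↦ (τ + (24 * n : ℕ) : ℂ)⁻¹) ?_))
    · rintro _ ⟨n, rfl⟩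
      have hn := congrFun hall (fricke (((24 * n : ℕ) : ℝ) +ᵥ τ))
      simp only [hx, hw, Pi.zero_apply] at hn
      rw [← map_evalRingHom_eval] at hn
      simpa [p, q, IsRoot.def] using hn
    · intro m n hmn
      simpa using hmn
  have hp : p = 0 := by
    rcases comp_eq_zero_iff.1 hcomp with h | ⟨-, h⟩
    · exact h
    · exfalso
      -- At these two points `q` takes the distinct values `0` and `x * d`, so it is not constant.
      have e0 := congrArg (eval ((3 * formB τ) / c)) h
      have e1 := congrArg (eval ((3 * formB τ - 1) / c)) h
      rw [eval_C] at e0 e1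
      rw [← e0] at e1
      simp [q, mul_div_cancel₀, hc0, hx0, hd0] at e1
  have := congrArg (fun r : ℂ[X] ↦ r.coeff j) hp
  simp only [p, coeff_map, coe_evalRingHom, coeff_zero] at this
  simp [this]

/-- Every nonzero polynomial has a nonzero multiple that is a polynomial in `Y ^ n`. -/
lemma exists_dvd_expand {K : Type*} [CommRing K] [IsDomain K] {n : ℕ} (hn : 0 < n) {P : K[X]}
    (hP : P ≠ 0) : ∃ Q : K[X], Q ≠ 0 ∧ P ∣ expand K n Q := by
  have hX : (expand K n : K[X] →+* K[X]).IsIntegralElem Polynomial.X := by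
    refine ⟨Polynomial.X ^ n - Polynomial.C Polynomial.X, monic_X_pow_sub_C _ hn.ne', ?_⟩
    simp
  have hint : ∀ p : K[X], (expand K n : K[X] →+* K[X]).IsIntegralElem p := fun p ↦ by
    induction p using Polynomial.induction_on with
    | C a => simpa using (expand K n : K[X] →+* K[X]).isIntegralElem_map (x := Polynomial.C a)
    | add p q hp hq => exact hp.add _ hq
    | monomial k a h =>
      rw [pow_succ, ← mul_assoc]
      exact h.mul _ hX
  obtain ⟨p, hp, hp0⟩ := hint P
  obtain ⟨i, hi, hmem⟩ := Ideal.exists_coeff_ne_zero_mem_comap_of_root_mem hP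
    (Ideal.mem_span_singleton_self P) hp.ne_zero hp0
  exact ⟨_, hi, Ideal.mem_span_singleton.1 hmem⟩

lemma evalEval_swap {K : Type*} [CommRing K] (x y : K) (p : K[X][X]) :
    (Bivariate.swap p).evalEval x y = p.evalEval y x := by
  induction p using Polynomial.induction_on' with
  | add p q hp hq => simp [hp, hq]
  | monomial n a =>
    rw [Bivariate.swap_monomial, evalEval_mul, evalEval_map_C, evalEval_C]
    simp [evalEval]

/-- `X = A³ / C` and `S = (A B - A³) / (6 C)` are algebraically independent. -/
lemma eq_zero_of_evalEval_X_S {R : ℂ[X][X]}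
    (h : ∀ᶠ τ in atImInfty, R.evalEval (formA τ ^ 3 / formC τ)
      ((formA τ * formB τ - formA τ ^ 3) / (6 * formC τ)) = 0) : R = 0 := by
  -- `S = (AB/C - X)/6`, so composing with `u` turns a relation between `X` and `S` into one between
  -- `X` and `AB/C`.
  let u : ℂ[X][X] := Polynomial.C (Polynomial.C (1 / 6)) * (Polynomial.X - Polynomial.C Polynomial.X)
  have hu : ∀ x y : ℂ, (R.comp u).evalEval x y = R.evalEval x ((y - x) / 6) := fun x y ↦ by
    rw [evalEval, eval_comp]
    have : eval (Polynomial.C y) u =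
        Polynomial.C (1 / 6) * (Polynomial.C y - Polynomial.X) := by simp [u]
    rw [this, ← map_evalRingHom_eval, ← coe_evalRingHom, ← eval₂_at_apply, eval₂_eq_eval_map]
    congr 1
    simp; ring
  by_contra hR
  have hcomp : R.comp u ≠ 0 := by
    rw [Ne, comp_eq_zero_iff]
    rintro (h | ⟨-, h⟩)
    · exact hR h
    · have := congrArg (fun r : ℂ[X][X] ↦ r.coeff 1) h
      simp [u, coeff_C] at this
  obtain ⟨Q, hQ, q, hq⟩ := exists_dvd_expand (n := 3) (by norm_num) hcomp
  refine hQ (eq_zero_of_evalEval_cubeForm ?_)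
  filter_upwards [h] with τ hτ
  have hC := formC_ne_zero τ
  have h1 : formA τ ^ 3 / formC τ = 1 + 27 * hauptmodul τ := by
    rw [formA_pow_three, mul_div_cancel_right₀ _ hC]
  have h3 : (formA τ * formB τ / formC τ) ^ 3 = cubeForm τ := by
    rw [div_pow, mul_pow, formA_pow_three, cubeForm]
    field_simp
  have h2 : (formA τ * formB τ - formA τ ^ 3) / (6 * formC τ) =
      (formA τ * formB τ / formC τ - (1 + 27 * hauptmodul τ)) / 6 := by
    rw [← h1]; field_simp
  rw [h2, h1, ← hu] at hτ
  have := congrArg (evalEval (1 + 27 * hauptmodul τ) (formA τ * formB τ / formC τ)) hq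
  rw [evalEval_mul, hτ, zero_mul, evalEval, expand_eval, ← C_pow, h3] at this
  exact this

/-! ### Germs at the cusp -/

lemma isUnit_coe {f : ℍ → ℂ} (hf : ∀ᶠ τ in atImInfty, f τ ≠ 0) : IsUnit (f : CuspGerm) := by
  refine IsUnit.of_mul_eq_one (f⁻¹ : ℍ → ℂ) ?_
  rw [← Germ.coe_mul]
  refine Germ.coe_eq.2 ?_
  filter_upwards [hf] with τ hτ
  simp [hτ]

lemma isUnit_qC : IsUnit qC := isUnit_coe (.of_forall formC_ne_zero)

lemma isUnit_qA : IsUnit qA := isUnit_coe <| by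
  filter_upwards [eventually_one_add_hauptmodul_ne_zero] with τ hτ h
  have := formA_pow_three τ
  rw [h, zero_pow three_ne_zero] at this
  exact mul_ne_zero hτ (formC_ne_zero τ) this.symm

/-- The germ of `A` as a unit. -/
def unitA : CuspGermˣ := isUnit_qA.unit

/-- The germ of `C` as a unit. -/
def unitC : CuspGermˣ := isUnit_qC.unit

/-- The germ of `X = A³ / C` as a unit. -/
def unitX : CuspGermˣ := unitA ^ 3 / unitC

lemma val_unitA : (unitA : CuspGerm) = qA := rfl

lemma val_unitC : (unitC : CuspGerm) = qC := rfl

lemma val_unitX : (unitX : CuspGerm) = qX := by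
  rw [unitX, Units.val_div_eq_div_val, Units.val_pow_eq_pow_val, val_unitA, val_unitC, qX]

/-- `(B - A²) / 6`. -/
def qB' : CuspGerm := (6 : ℚ)⁻¹ • (qB - qA ^ 2)

lemma qS_eq : qS = ↑(unitA / unitC) * qB' := by
  rw [Units.val_div_eq_div_val, val_unitA, val_unitC]
  refine congrArg (fun f : ℍ → ℂ ↦ (f : CuspGerm)) (a₁ := fun τ ↦
    (formA τ * formB τ - formA τ ^ 3) / (6 * formC τ)) (a₂ := fun τ ↦
    formA τ / formC τ * ((6 : ℚ)⁻¹ • (formB τ - formA τ ^ 2))) ?_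
  funext τ
  have := formC_ne_zero τ
  rw [Rat.smul_def]
  push_cast
  field_simp

/-- The substitution as a homomorphism of `ℚ`-algebras. -/
def substHom : LaurentXS →ₐ[ℚ] CuspGerm :=
  (LaurentPolynomial.eval₂ (aeval qS : ℚ[X] →ₐ[ℚ] CuspGerm).toRingHom unitX).toRatAlgHom

lemma substHom_C_mul_T (p : ℚ[X]) (i : ℤ) :
    substHom (LaurentPolynomial.C p * LaurentPolynomial.T i) = aeval qS p * ↑(unitX ^ i) := by
  exact LaurentPolynomial.eval₂_C_mul_T _ _ p i

lemma substHom_apply (f : LaurentXS) : substHom f = substABC f := by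
  conv_lhs => rw [← AddMonoidAlgebra.sum_coeff_single f]
  rw [substABC, map_finsuppSum]
  refine Finsupp.sum_congr fun i _ ↦ ?_
  rw [single_eq_C_mul_T, substHom_C_mul_T, mul_comm, Units.val_zpow_eq_zpow_val, val_unitX]

/-- Both sides are ring homomorphisms in `P` that agree on the two variables. -/
lemma eval₂_germ (P : ℚ[X][X]) :
    P.eval₂ (aeval qS : ℚ[X] →ₐ[ℚ] CuspGerm).toRingHom qX =
      (fun τ ↦ (P.map (mapRingHom (algebraMap ℚ ℂ))).evalEval
        ((formA τ * formB τ - formA τ ^ 3) / (6 * formC τ)) (formA τ ^ 3 / formC τ) : ℍ → ℂ) := by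
  let φ : ℚ[X][X] →+* CuspGerm := (Germ.coeRingHom atImInfty).comp <| RingHom.pi fun τ : ℍ ↦
    (evalEvalRingHom ((formA τ * formB τ - formA τ ^ 3) / (6 * formC τ))
      (formA τ ^ 3 / formC τ)).comp (mapRingHom (mapRingHom (algebraMap ℚ ℂ)))
  have : eval₂RingHom (aeval qS : ℚ[X] →ₐ[ℚ] CuspGerm).toRingHom qX = φ := by
    refine Polynomial.ringHom_ext' (Polynomial.ringHom_ext' (Subsingleton.elim _ _) ?_) ?_
    · simp only [RingHom.comp_apply, coe_eval₂RingHom, Polynomial.eval₂_C]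
      refine (aeval_X qS).trans ?_
      refine congrArg (fun f : ℍ → ℂ ↦ (f : CuspGerm)) (funext fun τ ↦ ?_)
      simp [RingHom.pi]
    · rw [coe_eval₂RingHom, eval₂_X]
      refine congrArg (fun f : ℍ → ℂ ↦ (f : CuspGerm)) (funext fun τ ↦ ?_)
      simp [RingHom.pi]
  exact congrArg (fun f : ℚ[X][X] →+* CuspGerm ↦ f P) this

lemma substHom_injective : Function.Injective substHom := by
  rw [injective_iff_map_eq_zero]
  intro f hf
  obtain ⟨n, P, hP⟩ := f.exists_T_pow
  have h0 : substHom (toLaurent P) = 0 := by rw [hP, map_mul, hf, zero_mul]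
  have h1 : P.eval₂ (aeval qS : ℚ[X] →ₐ[ℚ] CuspGerm).toRingHom qX = 0 := by
    rw [← val_unitX, ← LaurentPolynomial.eval₂_toLaurent]
    exact h0
  rw [eval₂_germ] at h1
  have h2 := Germ.coe_eq.1 h1
  -- In `P` the outer variable is `X`; in the independence lemma it is `S`.
  have hP0 : Bivariate.swap (P.map (mapRingHom (algebraMap ℚ ℂ))) = 0 := by
    refine eq_zero_of_evalEval_X_S ?_
    filter_upwards [h2] with τ hτ
    rw [evalEval_swap]
    exact hτ
  rw [EmbeddingLike.map_eq_zero_iff, Polynomial.map_eq_zero_iff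
    (Polynomial.map_injective _ (algebraMap ℚ ℂ).injective)] at hP0
  rw [hP0, map_zero] at hP
  exact (isUnit_T (n : ℤ)).mul_left_eq_zero.1 hP.symm

/-! ### The two spaces -/

/-- The span of the monomials of weight `n` in `A`, `(B - A²) / 6` and `C`. -/
def monomialSpan (n : ℕ) : Submodule ℚ CuspGerm :=
  Submodule.span ℚ {x | ∃ a b c : ℕ, a + 2 * b + 3 * c = n ∧ x = qA ^ a * qB' ^ b * qC ^ c}

lemma mul_mem_monomialSpan {m n : ℕ} {x y : CuspGerm} (hx : x ∈ monomialSpan m)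
    (hy : y ∈ monomialSpan n) : x * y ∈ monomialSpan (m + n) := by
  have := Submodule.mul_mem_mul hx hy
  rw [monomialSpan, monomialSpan, Submodule.span_mul_span] at this
  refine Submodule.span_mono ?_ this
  rintro _ ⟨_, ⟨a, b, c, h, rfl⟩, _, ⟨a', b', c', h', rfl⟩, rfl⟩
  exact ⟨a + a', b + b', c + c', by omega, by simp only [pow_add]; ring⟩

lemma pow_mem_monomialSpan {n : ℕ} {x : CuspGerm} (hx : x ∈ monomialSpan n) (k : ℕ) :
    x ^ k ∈ monomialSpan (k * n) := by
  induction k with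
  | zero => exact Submodule.subset_span ⟨0, 0, 0, by simp, by simp⟩
  | succ k ih =>
    rw [pow_succ, add_mul, one_mul]
    exact mul_mem_monomialSpan ih hx

/-- `B = 6B' + A²` is an invertible change of generators that respects weights. -/
lemma weightPart_eq (n : ℕ) : weightPart n = monomialSpan n := by
  apply le_antisymm
  · rintro _ ⟨p, hp, rfl⟩
    have hA : qA ∈ monomialSpan 1 := Submodule.subset_span ⟨1, 0, 0, by simp, by simp⟩
    have hC : qC ∈ monomialSpan 3 := Submodule.subset_span ⟨0, 0, 1, by simp, by simp⟩
    have hB' : qB' ∈ monomialSpan 2 := Submodule.subset_span ⟨0, 1, 0, by simp, by simp⟩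
    have hB : qB ∈ monomialSpan 2 := by
      have : qB = (6 : ℚ) • qB' + qA ^ 2 := by rw [qB', smul_smul]; simp
      rw [this]
      exact add_mem (Submodule.smul_mem _ _ hB') (pow_mem_monomialSpan hA 2)
    change MvPolynomial.aeval ![qA, qB, qC] p ∈ _
    rw [MvPolynomial.aeval_def, MvPolynomial.eval₂_eq']
    refine Submodule.sum_mem _ fun d hd ↦ ?_
    have hw := hp (MvPolynomial.mem_support_iff.1 hd)
    rw [← Algebra.smul_def]
    refine Submodule.smul_mem _ _ ?_
    rw [Finsupp.weight_apply, Finsupp.sum_fintype _ _ (by simp)] at hw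
    simp only [Fin.sum_univ_three, Fin.prod_univ_three] at hw ⊢
    have := mul_mem_monomialSpan (mul_mem_monomialSpan (pow_mem_monomialSpan hA (d 0))
      (pow_mem_monomialSpan hB (d 1))) (pow_mem_monomialSpan hC (d 2))
    rw [← hw]
    exact this
  · refine Submodule.span_le.2 ?_
    rintro _ ⟨a, b, c, h, rfl⟩
    refine ⟨MvPolynomial.X 0 ^ a * (MvPolynomial.C (6 : ℚ)⁻¹ *
      (MvPolynomial.X 1 - MvPolynomial.X 0 ^ 2)) ^ b * MvPolynomial.X 2 ^ c, ?_, ?_⟩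
    · have h0 := MvPolynomial.isWeightedHomogeneous_X ℚ (![1, 2, 3] : Fin 3 → ℕ) 0
      have h1 := MvPolynomial.isWeightedHomogeneous_X ℚ (![1, 2, 3] : Fin 3 → ℕ) 1
      have h2 := MvPolynomial.isWeightedHomogeneous_X ℚ (![1, 2, 3] : Fin 3 → ℕ) 2
      have h6 := MvPolynomial.isWeightedHomogeneous_C (![1, 2, 3] : Fin 3 → ℕ) (6 : ℚ)⁻¹
      have := ((h0.pow a).mul ((h6.mul (h1.sub (h0.pow 2))).pow b)).mul (h2.pow c)
      have hw : a • (![1, 2, 3] : Fin 3 → ℕ) 0 + b • (0 + (![1, 2, 3] : Fin 3 → ℕ) 1) +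
          c • (![1, 2, 3] : Fin 3 → ℕ) 2 = n := by
        simp
        omega
      rw [hw] at this
      exact this
    · simp [qB', Algebra.smul_def]

/-- The Laurent polynomials all of whose monomials `X ^ i * S ^ k` satisfy `i + k ≤ m`. -/
def degreeLE (m : ℤ) : Submodule ℚ LaurentXS where
  carrier := {f | ∀ (i : ℤ) (k : ℕ), (f.coeff i).coeff k ≠ 0 → i + k ≤ m}
  zero_mem' := by intro i k h; simp at h
  add_mem' := by
    intro f f' hf hf' i k h
    by_cases h0 : (f.coeff i).coeff k = 0
    · refine hf' i k fun h1 => h ?_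
      simp [h0, h1]
    · exact hf i k h0
  smul_mem' := by
    intro r f hf i k h
    refine hf i k fun h0 => h ?_
    simp [h0]

lemma coeff_coeff_monomial (i j : ℤ) (k l : ℕ) :
    ((LaurentPolynomial.C (Polynomial.X ^ k) * LaurentPolynomial.T i : LaurentXS).coeff j).coeff l =
      if i = j ∧ k = l then 1 else 0 := by
  rw [← single_eq_C_mul_T, AddMonoidAlgebra.coeff_single, Finsupp.single_apply]
  split_ifs <;> simp_all [coeff_X_pow, eq_comm]

lemma ofPoly_monomial (d : Fin 2 →₀ ℕ) (r : ℚ) : ofPoly (MvPolynomial.monomial d r) =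
    r • (LaurentPolynomial.C (Polynomial.X ^ d 1) * LaurentPolynomial.T (d 0)) := by
  rw [ofPoly, MvPolynomial.aeval_monomial, Algebra.smul_def, Finsupp.prod_fintype _ _ (by simp)]
  simp [Fin.prod_univ_two, T_pow, mul_comm]

/-- The bound is `(3g-3) - (g-1)`. The other constraint, `i ≥ -(g-1)`, may be forgotten: it follows
from this bound and regularity. -/
lemma shiftedSpace_le (g : ℕ) (hg : 1 ≤ g) : shiftedSpace g ≤ degreeLE (2 * g - 2) := by
  rintro _ ⟨_, ⟨p, hp, rfl⟩, rfl⟩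
  change LaurentPolynomial.T (-((g : ℤ) - 1)) * ofPoly p ∈ _
  rw [← MvPolynomial.support_sum_monomial_coeff p, map_sum, Finset.mul_sum]
  refine Submodule.sum_mem _ fun d hd ↦ ?_
  have hd' : d 0 + d 1 ≤ 3 * g - 3 := by
    have := hp hd
    simpa [Finsupp.sum_fintype, Fin.sum_univ_two] using this
  rw [ofPoly_monomial, mul_smul_comm]
  refine Submodule.smul_mem _ _ ?_
  rw [T_mul, mul_T_assoc]
  intro i k h
  rw [coeff_coeff_monomial] at h
  have := (ite_ne_right_iff.1 h).1
  omega

lemma monomial_mem_regularSpace {g k : ℕ} {i : ℤ} (hik : i + k ≤ 2 * g - 2) (hreg : 0 ≤ 3 * i + k) :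
    LaurentPolynomial.C (Polynomial.X ^ k) * LaurentPolynomial.T i ∈ regularSpace g := by
  -- Subtracting `hik` from `hreg` gives `2i ≥ -(2g-2)`, so `i + (g-1)` is nonnegative.
  obtain ⟨m, hm⟩ : ∃ m : ℕ, (m : ℤ) = i + (g - 1) := ⟨(i + (g - 1)).toNat, by omega⟩
  refine ⟨⟨_, ⟨MvPolynomial.X 0 ^ m * MvPolynomial.X 1 ^ k, ?_, rfl⟩, ?_⟩, ?_⟩
  · rw [SetLike.mem_coe, MvPolynomial.mem_restrictTotalDegree]
    refine (MvPolynomial.totalDegree_mul _ _).trans ?_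
    rw [MvPolynomial.totalDegree_X_pow, MvPolynomial.totalDegree_X_pow]
    omega
  · change LaurentPolynomial.T (-((g : ℤ) - 1)) * ofPoly _ = _
    simp only [ofPoly, map_mul, map_pow, MvPolynomial.aeval_X, Matrix.cons_val_zero,
      Matrix.cons_val_one, T_pow]
    rw [mul_comm, mul_right_comm, ← T_add, mul_comm]
    congr 2
    omega
  · intro j l h
    rw [coeff_coeff_monomial] at h
    obtain ⟨rfl, rfl⟩ := (ite_ne_right_iff.1 h).1
    exact hreg

lemma substHom_monomial {g a k c : ℕ} {i : ℤ} (ha : (a : ℤ) = 3 * i + k)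
    (hc : (c : ℤ) = 2 * g - 2 - i - k) :
    substHom (LaurentPolynomial.C (Polynomial.X ^ k) * LaurentPolynomial.T i) =
      qC ^ (-(2 * (g : ℤ) - 2)) * (qA ^ a * qB' ^ k * qC ^ c) := by
  rw [substHom_C_mul_T, map_pow, aeval_X, qS_eq, mul_pow, ← val_unitC, ← val_unitA,
    ← Units.val_zpow_eq_zpow_val, ← Units.val_pow_eq_pow_val, ← Units.val_pow_eq_pow_val,
    ← Units.val_pow_eq_pow_val, mul_right_comm, mul_right_comm (_ : CuspGerm) (qB' ^ k),
    ← mul_assoc, ← Units.val_mul, ← Units.val_mul, ← Units.val_mul]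
  congr 2
  rw [unitX, div_zpow, div_pow, ← zpow_natCast unitA a, ← zpow_natCast unitC c, ha, hc]
  simp only [← zpow_natCast, ← zpow_mul, div_eq_mul_inv, ← zpow_neg]
  rw [mul_mul_mul_comm, mul_left_comm (unitC ^ (-(2 * (g : ℤ) - 2))), ← zpow_add, ← zpow_add, ← zpow_add]
  congr 2 <;> push_cast <;> ring

lemma map_regularSpace (g : ℕ) (hg : 1 ≤ g) :
    (regularSpace g).map substHom.toLinearMap = quasimodularSpace g := by
  rw [quasimodularSpace, weightPart_eq]
  apply le_antisymm
  · rintro _ ⟨f, ⟨hf, hreg⟩, rfl⟩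
    have hdeg := shiftedSpace_le g hg hf
    change substHom f ∈ _
    rw [← AddMonoidAlgebra.sum_coeff_single f, map_finsuppSum]
    refine Submodule.sum_mem _ fun i _ ↦ ?_
    change substHom (AddMonoidAlgebra.single i (f.coeff i)) ∈ _
    rw [single_eq_C_mul_T, (f.coeff i).as_sum_support_C_mul_X_pow, map_sum, Finset.sum_mul, map_sum]
    refine Submodule.sum_mem _ fun k hk ↦ ?_
    have h0 := mem_support_iff.1 hk
    have h1 : i + k ≤ 2 * g - 2 := hdeg i k h0
    have h2 := hreg i k h0
    obtain ⟨a, ha⟩ := Int.eq_ofNat_of_zero_le h2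
    obtain ⟨c, hc⟩ := Int.eq_ofNat_of_zero_le (sub_nonneg.2 h1)
    rw [← Polynomial.smul_eq_C_mul, ← single_eq_C_mul_T, ← AddMonoidAlgebra.smul_single,
      single_eq_C_mul_T, map_smul, substHom_monomial (g := g) ha.symm (c := c) (by omega)]
    refine Submodule.smul_mem _ _ ⟨_, Submodule.subset_span ⟨a, k, c, ?_, rfl⟩, rfl⟩
    omega
  · rintro _ ⟨y, hy, rfl⟩
    change qC ^ (-(2 * (g : ℤ) - 2)) * y ∈ _
    induction hy using Submodule.span_induction with
    | mem y hy =>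
      obtain ⟨a, b, c, h, rfl⟩ := hy
      -- The weight equation `a + 2b + 3c = 6g-6` forces `a ≡ b` modulo `3`, so the division is
      -- exact.
      obtain ⟨i, hi⟩ : ∃ i : ℤ, (a : ℤ) = 3 * i + b := ⟨((a : ℤ) - b) / 3, by omega⟩
      exact ⟨_, monomial_mem_regularSpace (k := b) (i := i) (by omega) (by omega),
        substHom_monomial hi (by omega)⟩
    | zero => simp
    | add y z _ _ hy hz => rw [mul_add]; exact add_mem hy hz
    | smul r y _ hy => rw [mul_smul_comm]; exact Submodule.smul_mem _ _ hy

end LocalP2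

end


theorem proposition4p3 (g : ℕ) (hg : 2 ≤ g) :
    ∃ e : LocalP2.regularSpace g ≃ₗ[ℚ] LocalP2.quasimodularSpace g,
      ∀ f : LocalP2.regularSpace g,
        (e f : LocalP2.CuspGerm) = LocalP2.substABC (f : LocalP2.LaurentXS) := by
  refine ⟨(Submodule.equivMapOfInjective LocalP2.substHom.toLinearMap
    LocalP2.substHom_injective (LocalP2.regularSpace g)).trans
      (LinearEquiv.ofEq _ _ (LocalP2.map_regularSpace g (by omega))), fun f ↦ ?_⟩
  exact LocalP2.substHom_apply f
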